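/- All graphs are simple, undirected and connected. A graph $G$ with vertex set $V$ and path metric $d$ is a \emph{Helly graph} if every family of pairwise intersecting balls $B_r(v)=\{x\in V: d(v,x)\le r\}$ has a non-empty intersection. The \emph{injective hull} $E(G)$ of $(V,d)$ is the set of all pointwise minimal functions among the functions $f:V\to\mathbb R$ with $f(x)+f(y)\ge d(x,y)$ for all $x,y\in V$, equipped with the metric $d_\infty(f,g)=\sup_{x\in V}|f(x)-g(x)|$; the map $e:V\to E(G)$, $e(v)=d(v,\cdot)$, is an isometric embedding, and the automorphisms $\varphi$ of $G$ act on $E(G)$ by the isometries $f\mapsto f\circ\varphi^{-1}$. A metric space is \emph{injective} if $1$-Lipschitz maps into it from arbitrary subsets of metric spaces extend to $1$-Lipschitz maps on the whole space. \textbf{Theorem.} Let $G$ be a locally finite Helly graph. Then: (1) $E(G)$ is proper, i.e. its closed bounded subsets are compact. (2) $E(G)$ has the structure of a locally finite polyhedral complex such that, for every $n$, there are only finitely many isometry types of $n$-cells, and every $n$-cell is isometric to an injective polytope in $\ell_\infty^n=(\mathbb R^n,\|\cdot\|_\infty)$. More precisely, the cells are polytopes in the vector space $\mathbb R^V$ with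 union $E(G)$, faces of cells are cells, two cells that meet intersect in a common face, every point of $E(G)$ has a neighbourhood meeting only finitely many cells, and the isometries of the $n$-cells onto polytopes in $\ell_\infty^n$ can be chosen affine. The automorphisms of $G$ act on this complex by cellular automorphisms. (3) The Hausdorff distance between $E(G)$ and $e(V)$ is at most $1$. (4) Let a group $\Gamma$ act on $G$ by automorphisms. If the action on $G$ is proper (the stabilizers of vertices are finite), then the induced isometric action of $\Gamma$ on $E(G)$ is proper (for every compact $K\subseteq E(G)$ the set $\{g\in\Gamma: gK\cap K\neq\emptyset\}$ is finite). If the action on $G$ is geometric (proper, and with finitely many orbits of vertices), then the induced action on $E(G)$ is geometric (proper, and the translates of some compact set cover $E(G)$). -/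

import Mathlib

universe u v w

open Set

/-! ### Injective metric spaces and injective hulls -/

/-- A metric space `X` is injective if every `1`-Lipschitz map from a subset `A` of a metric space
`Y` to `X` extends to a `1`-Lipschitz map `Y → X`. -/
def IsInjectiveMetricSpace (X : Type u) [MetricSpace X] : Prop :=
  ∀ (Y : Type w) [MetricSpace Y] (A : Set Y) (f : A → X), LipschitzWith 1 f →
    ∃ g : Y → X, LipschitzWith 1 g ∧ ∀ a : A, g a = f a

/-- The metric forms on `X`. -/
def metricForms (X : Type u) [MetricSpace X] : Set (X → ℝ) :=
  {f | ∀ x y, dist x y ≤ f x + f y}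

/-- The extremal (pointwise minimal) metric forms on `X`. -/
def extremalForms (X : Type u) [MetricSpace X] : Set (X → ℝ) :=
  {f | f ∈ metricForms X ∧ ∀ g ∈ metricForms X, g ≤ f → g = f}

/-- The injective hull `E(X)` of a metric space `X`, in Isbell's construction: the set of extremal
metric forms, to be equipped with the sup-metric. -/
def InjectiveHull (X : Type u) [MetricSpace X] : Type u := {f : X → ℝ // f ∈ extremalForms X}

namespace InjectiveHull

section

variable {X : Type u} [MetricSpace X]

theorem nonneg (f : InjectiveHull X) (x : X) : 0 ≤ f.1 x := by
  have h := f.2.1 x x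
  rw [dist_self] at h
  linarith

theorem le_add_dist (f : InjectiveHull X) (x y : X) : f.1 y ≤ f.1 x + dist x y := by
  classical
  by_contra! hlt
  have hform : Function.update f.1 y (f.1 x + dist x y) ∈ metricForms X := by
    intro a b
    have hxx := f.nonneg x
    by_cases ha : a = y <;> by_cases hb : b = y
    · rw [ha, hb]
      simp only [Function.update_self, dist_self]
      have := dist_nonneg (x := x) (y := y)
      linarith
    · subst ha
      simp only [Function.update_self, Function.update_of_ne hb]
      have h1 := f.2.1 x b
      have h2 := dist_triangle a x b
      rw [dist_comm a x] at h2
      linarith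
    · subst hb
      simp only [Function.update_self, Function.update_of_ne ha]
      have h1 := f.2.1 a x
      have h2 := dist_triangle a x b
      linarith
    · simp only [Function.update_of_ne ha, Function.update_of_ne hb]
      exact f.2.1 a b
  have hle : Function.update f.1 y (f.1 x + dist x y) ≤ f.1 := by
    intro a
    by_cases ha : a = y
    · subst ha
      simpa using hlt.le
    · simp [Function.update_of_ne ha]
  have heq := congrFun (f.2.2 _ hform hle) y
  rw [Function.update_self] at heq
  linarith

theorem bddAbove_abs_sub (f g : InjectiveHull X) :
    BddAbove (range fun x => |f.1 x - g.1 x|) := by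
  rcases isEmpty_or_nonempty X with hX | ⟨⟨x⟩⟩
  · exact ⟨0, by rintro _ ⟨x, -⟩; exact hX.elim x⟩
  · refine ⟨f.1 x + g.1 x, ?_⟩
    rintro _ ⟨y, rfl⟩
    have h1 := f.le_add_dist x y
    have h2 := g.2.1 x y
    have h3 := g.le_add_dist x y
    have h4 := f.2.1 x y
    exact abs_le.2 ⟨by linarith, by linarith⟩

/-- The sup-metric `d_∞` on the injective hull. -/
noncomputable instance : MetricSpace (InjectiveHull X) where
  dist f g := ⨆ x, |f.1 x - g.1 x|
  dist_self f := by simp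
  dist_comm f g := by simp only [abs_sub_comm]
  dist_triangle f g h := by
    refine Real.iSup_le (fun x => ?_) ?_
    · exact (abs_sub_le _ (g.1 x) _).trans
        (add_le_add (le_ciSup (bddAbove_abs_sub f g) x) (le_ciSup (bddAbove_abs_sub g h) x))
    · exact add_nonneg (Real.iSup_nonneg fun x => abs_nonneg _)
        (Real.iSup_nonneg fun x => abs_nonneg _)
  eq_of_dist_eq_zero {f g} h := by
    apply Subtype.ext
    funext x
    have hx : |f.1 x - g.1 x| ≤ 0 := h ▸ le_ciSup (bddAbove_abs_sub f g) x
    exact sub_eq_zero.1 (abs_nonpos_iff.1 hx)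

/-- The canonical embedding `e : X → E(X)`, `e x = d(x, ·)`. -/
def e (x : X) : InjectiveHull X :=
  ⟨fun y => dist x y, fun a b => by simpa [dist_comm x a] using dist_triangle a x b, by
    intro g hg hle
    funext y
    refine le_antisymm (hle y) ?_
    have h1 := hg x y
    have h2 := hle x
    simp only [dist_self] at h2
    linarith⟩

/-- An isometry `φ` of `X` acts on real functions on `X` by `f ↦ f ∘ φ⁻¹`; this map preserves the
extremal forms. -/
theorem comp_symm_mem (φ : X ≃ᵢ X) {f : X → ℝ} (hf : f ∈ extremalForms X) :
    (fun x => f (φ.symm x)) ∈ extremalForms X := by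
  refine ⟨fun x y => ?_, fun g hg hle => ?_⟩
  · have h := hf.1 (φ.symm x) (φ.symm y)
    rwa [φ.symm.dist_eq] at h
  · have h := hf.2 (fun x => g (φ x)) (fun x y => by rw [← φ.dist_eq]; exact hg (φ x) (φ y))
      (fun x => by simpa using hle (φ x))
    funext x
    simpa using congrFun h (φ.symm x)

/-- The isometry `f ↦ f ∘ φ⁻¹` of `E(X)` induced by an isometry `φ` of `X`. -/
noncomputable def mapIsometry (φ : X ≃ᵢ X) : InjectiveHull X ≃ᵢ InjectiveHull X where
  toFun f := ⟨fun x => f.1 (φ.symm x), comp_symm_mem φ f.2⟩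
  invFun f := ⟨fun x => f.1 (φ x), comp_symm_mem φ.symm f.2⟩
  left_inv f := by
    apply Subtype.ext
    funext x
    simp
  right_inv f := by
    apply Subtype.ext
    funext x
    simp
  isometry_toFun := Isometry.of_dist_eq fun f g =>
    φ.symm.toEquiv.iSup_congr (g := fun x => |f.1 x - g.1 x|) fun x => rfl

/-- The action of the isometry group of `X` on `E(X)`. -/
noncomputable def isometryAction : (X ≃ᵢ X) →* (InjectiveHull X ≃ᵢ InjectiveHull X) where
  toFun := mapIsometry
  map_one' := rfl
  map_mul' _ _ := rfl

end

end InjectiveHull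

/-! ### Polytopes and polyhedral complexes -/

section Polyhedral

variable {W : Type u} [AddCommGroup W] [Module ℝ W]

/-- A (nonempty, convex, compact) polytope: the convex hull of a nonempty finite set. -/
def IsPolytope (C : Set W) : Prop :=
  ∃ s : Set W, s.Finite ∧ s.Nonempty ∧ C = convexHull ℝ s

/-- `F` is a face of the polytope `C`: the set of points of `C` at which some linear functional
attains its maximum over `C`. (In particular `C` is a face of itself.) -/
def IsFace (C F : Set W) : Prop :=
  ∃ l : W →ₗ[ℝ] ℝ, F = {x | x ∈ C ∧ ∀ y ∈ C, l y ≤ l x}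

/-- The dimension of a polytope. -/
noncomputable def polytopeDim (C : Set W) : ℕ := Module.finrank ℝ (vectorSpan ℝ C)

/-- A polyhedral complex in a real vector space `W`: a set of polytopes (the closed cells) that is
closed under taking faces, such that two cells that meet do so in a common face. -/
structure PolyhedralComplex (W : Type u) [AddCommGroup W] [Module ℝ W] where
  cells : Set (Set W)
  isPolytope : ∀ C ∈ cells, IsPolytope C
  face_mem : ∀ C ∈ cells, ∀ F, IsFace C F → F ∈ cells
  inter_isFace : ∀ C ∈ cells, ∀ D ∈ cells, (C ∩ D).Nonempty →
    IsFace C (C ∩ D) ∧ IsFace D (C ∩ D)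

end Polyhedral

/-- An injective polytope in `ℓ_∞^n`, that is, in `Fin n → ℝ` with the sup-norm: a polytope which is
an injective metric space for the induced metric. -/
def IsInjectivePolytope {n : ℕ} (P : Set (Fin n → ℝ)) : Prop :=
  IsPolytope P ∧ IsInjectiveMetricSpace.{0, w} P

/-- A polytope `C` of functions on `X` that consists of points of `E(X)` is, with the metric of
`E(X)`, isometric to the polytope `P` of `ℓ_∞^n`, through an isometry which is affine. -/
def CellIsometricTo {X : Type u} [MetricSpace X] (C : Set (X → ℝ)) {n : ℕ}
    (P : Set (Fin n → ℝ)) : Prop :=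
  ∃ φ : (X → ℝ) →ᵃ[ℝ] (Fin n → ℝ), φ '' C = P ∧
    ∀ f g : InjectiveHull X, f.1 ∈ C → g.1 ∈ C → dist (φ f.1) (φ g.1) = dist f g

/-- `K` is a structure of a locally finite polyhedral complex on `E(X)` (an affine one: the cells
are polytopes in the vector space of functions on `X`) with, for every `n`, only finitely many
isometry types of `n`-cells, all of them isometric to injective polytopes in `ℓ_∞^n`. -/
structure IsInjectiveHullComplex (X : Type u) [MetricSpace X]
    (K : PolyhedralComplex (X → ℝ)) : Prop where
  /-- The cells cover exactly `E(X)`. -/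
  sUnion_cells : ⋃₀ K.cells = extremalForms X
  /-- Every point of `E(X)` has a `d_∞`-neighbourhood that meets only finitely many cells. -/
  locallyFinite : LocallyFinite fun C : K.cells => {f : InjectiveHull X | f.1 ∈ C.1}
  /-- Finitely many isometry types of `n`-cells, each that of an injective polytope. -/
  finite_types : ∀ n : ℕ, ∃ T : Set (Set (Fin n → ℝ)), T.Finite ∧
    (∀ P ∈ T, IsInjectivePolytope.{w} P) ∧
    ∀ C ∈ K.cells, polytopeDim C = n → ∃ P ∈ T, CellIsometricTo C P

/-- The isometry `φ` of `X` acts on `E(X)` by a cellular automorphism of `K`: the linear map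
`f ↦ f ∘ φ⁻¹` permutes the cells. -/
def IsCellular {X : Type u} [MetricSpace X] (K : PolyhedralComplex (X → ℝ)) (φ : X ≃ᵢ X) : Prop :=
  ∀ C : Set (X → ℝ), C ∈ K.cells ↔ (fun (f : X → ℝ) (x : X) => f (φ.symm x)) '' C ∈ K.cells

/-! ### Helly graphs -/

section Graph

variable {V : Type u}

/-- A family of sets has the Helly property if every pairwise intersecting subfamily has a nonempty
intersection. -/
def HellyProperty (F : Set (Set V)) : Prop :=
  ∀ S ⊆ F, (∀ A ∈ S, ∀ B ∈ S, (A ∩ B).Nonempty) → (⋂₀ S).Nonempty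

/-- The balls `B_r(v)` of a (connected) graph. -/
def graphBalls (G : SimpleGraph V) : Set (Set V) :=
  {B | ∃ (c : V) (r : ℕ), B = {x | G.dist c x ≤ r}}

/-- A graph is Helly if it is connected and its family of balls has the Helly property. -/
def IsHellyGraph (G : SimpleGraph V) : Prop :=
  G.Connected ∧ HellyProperty (graphBalls G)

/-- Every vertex has finitely many neighbours. -/
def IsLocallyFiniteGraph (G : SimpleGraph V) : Prop :=
  ∀ x, (G.neighborSet x).Finite

/-- The vertex set of a connected graph `G`, as a metric space with the path metric. -/
def VertexSpace (G : SimpleGraph V) (_hG : G.Connected) : Type u := V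

noncomputable instance (G : SimpleGraph V) (hG : G.Connected) : MetricSpace (VertexSpace G hG) where
  dist x y := (G.dist (x : V) (y : V) : ℝ)
  dist_self _ := Nat.cast_eq_zero.2 SimpleGraph.dist_self
  dist_comm _ _ := congrArg (Nat.cast : ℕ → ℝ) SimpleGraph.dist_comm
  dist_triangle _ _ _ := by exact_mod_cast hG.dist_triangle
  eq_of_dist_eq_zero {x y} h := hG.dist_eq_zero_iff.1 (by exact_mod_cast h)

theorem dist_le_of_iso (G : SimpleGraph V) (hG : G.Connected) (φ : G ≃g G) (x y : V) :
    G.dist (φ x) (φ y) ≤ G.dist x y := by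
  obtain ⟨p, hp⟩ := hG.exists_walk_length_eq_dist x y
  rw [← hp, ← SimpleGraph.Walk.length_map φ.toHom p]
  exact SimpleGraph.dist_le _

theorem dist_eq_of_iso (G : SimpleGraph V) (hG : G.Connected) (φ : G ≃g G) (x y : V) :
    G.dist (φ x) (φ y) = G.dist x y := by
  refine le_antisymm (dist_le_of_iso G hG φ x y) ?_
  simpa using dist_le_of_iso G hG φ.symm (φ x) (φ y)

/-- Graph automorphisms are isometries for the path metric. -/
noncomputable def autToIsometry (G : SimpleGraph V) (hG : G.Connected) :
    (G ≃g G) →* (VertexSpace G hG ≃ᵢ VertexSpace G hG) where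
  toFun φ :=
    { toEquiv := φ.toEquiv
      isometry_toFun := Isometry.of_dist_eq fun x y =>
        congrArg (Nat.cast : ℕ → ℝ) (dist_eq_of_iso G hG φ x y) }
  map_one' := rfl
  map_mul' _ _ := rfl

/-- The action on the injective hull `E(G)` of the automorphisms of the graph `G`. -/
noncomputable def autHullAction (G : SimpleGraph V) (hG : G.Connected) :
    (G ≃g G) →* (InjectiveHull (VertexSpace G hG) ≃ᵢ InjectiveHull (VertexSpace G hG)) :=
  InjectiveHull.isometryAction.comp (autToIsometry G hG)

/-! ### Proper and geometric actions -/

/-- A group acts properly on a locally finite graph if the stabilizers of vertices are finite.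
(Then so are the stabilizers of edges, which have subgroups of index at most two fixing a
vertex.) -/
def ActsProperlyOnGraph {Γ : Type v} [Group Γ] {G : SimpleGraph V} (ρ : Γ →* (G ≃g G)) : Prop :=
  ∀ x : V, {g : Γ | ρ g x = x}.Finite

/-- A group acts cocompactly on a locally finite graph if there are finitely many orbits of
vertices (and hence of edges). -/
def ActsCocompactlyOnGraph {Γ : Type v} [Group Γ] {G : SimpleGraph V} (ρ : Γ →* (G ≃g G)) : Prop :=
  ∃ S : Set V, S.Finite ∧ ∀ x : V, ∃ g : Γ, ∃ s ∈ S, ρ g s = x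

/-- A geometric action on a graph is a proper and cocompact one. -/
def ActsGeometricallyOnGraph {Γ : Type v} [Group Γ] {G : SimpleGraph V} (ρ : Γ →* (G ≃g G)) :
    Prop :=
  ActsProperlyOnGraph ρ ∧ ActsCocompactlyOnGraph ρ

end Graph

/-- An isometric action is proper if, for every compact set `K`, only finitely many group elements
`g` satisfy `g K ∩ K ≠ ∅`. (In a locally finite complex with compact cells, the stabilizers of cells
are then finite.) -/
def ActsProperly {Γ : Type v} [Group Γ] {E : Type u} [MetricSpace E] (ρ : Γ →* (E ≃ᵢ E)) : Prop :=
  ∀ K : Set E, IsCompact K → {g : Γ | (ρ g '' K ∩ K).Nonempty}.Finite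

/-- An isometric action is cocompact if the translates of some compact set cover the space. -/
def ActsCocompactly {Γ : Type v} [Group Γ] {E : Type u} [MetricSpace E] (ρ : Γ →* (E ≃ᵢ E)) :
    Prop :=
  ∃ K : Set E, IsCompact K ∧ ⋃ g : Γ, ρ g '' K = univ

/-- A geometric action is a proper and cocompact action by isometries. -/
def ActsGeometrically {Γ : Type v} [Group Γ] {E : Type u} [MetricSpace E] (ρ : Γ →* (E ≃ᵢ E)) :
    Prop :=
  ActsProperly ρ ∧ ActsCocompactly ρ

/-! The cell of an extremal form f consists of the metric forms that are tight (g x + g y = d(x, y))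
wherever f is. The main tool is a reduction to small values: each x has a z with f z < 3/2 and f x =
f z + d(x, z) (`exists_eq_add_dist`), by the Helly property applied to balls with rounded radii.
Balls are finite, so only finitely many z occur. Hence the slacks f x + f y - d(x, y) lie in
finitely many classes modulo ℤ, and the positive ones are bounded away from 0 (`exists_gap`). So
every point has a tight partner, and f can be moved both ways along `tightSpace f` inside its cell.
On a cell, every coordinate differs by a constant from one with values in [0, 2]
(`exists_mem_smallCoords`).

At an extreme point the tight space vanishes, which forces half-integral values, and only finitely
many half-integral extremal forms are bounded at a given point. Krein–Milman then makes cells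
polytopes, and a bounded region meets finitely many of them: this gives local finiteness and
properness. Faces and intersections are the cells of their generic points.

Coordinates that agree up to sign on the tight space are grouped together; one representative per
nonzero group embeds an n-cell isometrically in ℓ_∞^n with vertices on the half-integral grid of [0,
2]^n, so there are finitely many types. Injectivity of a cell comes from a minimal solution of
inequalities on Y × X (`exists_lipschitz_extension_tightCell`). Finally, some v has f v ≤ 1, and
d_∞(f, e v) ≤ f v; this gives the Hausdorff bound and cocompactness. -/

/-! ### Metric forms, tight cells and their injectivity. -/

section TightCells

/-- Below every solution of a system of inequalities `c i j ≤ h i + h j` there is a minimal one. -/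
theorem exists_minimal_le_of_add_ge {I : Type*} (c : I → I → ℝ) (hc : ∀ i j, c i j = c j i)
    (H : I → ℝ) (hH : ∀ i j, c i j ≤ H i + H j) :
    ∃ H' ≤ H, (∀ i j, c i j ≤ H' i + H' j) ∧
      ∀ i, ∀ ε > 0, ∃ j, H' i + H' j < c i j + ε := by
  classical
  let S : Set (I → ℝ) := {h | ∀ i j, c i j ≤ h i + h j}
  obtain ⟨m, hmH, hmS, hm⟩ : ∃ m : I → ℝ, m ≤ H ∧ (∀ i j, c i j ≤ m i + m j) ∧
      ∀ h : I → ℝ, (∀ i j, c i j ≤ h i + h j) → h ≤ m → m ≤ h := by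
    obtain ⟨m, hmH, hm⟩ := zorn_le_nonempty₀ (α := (I → ℝ)ᵒᵈ) (OrderDual.ofDual ⁻¹' S) (by
      intro C hCS hC h₀ h₀C
      let C' : Set (I → ℝ) := OrderDual.toDual ⁻¹' C
      have hlow : ∀ h ∈ C', ∀ i, c i i / 2 ≤ h i := fun h hh i => by
        have := hCS hh i i
        change c i i ≤ h i + h i at this
        linarith
      have hbdd : ∀ i, BddBelow (range fun h : C' => h.1 i) := fun i =>
        ⟨c i i / 2, by rintro _ ⟨h, rfl⟩; exact hlow h.1 h.2 i⟩
      have : Nonempty C' := ⟨⟨h₀, h₀C⟩⟩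
      refine ⟨OrderDual.toDual fun i => ⨅ h : C', h.1 i, ?_, ?_⟩
      · intro i j
        change c i j ≤ (⨅ h : C', h.1 i) + ⨅ h : C', h.1 j
        refine le_ciInf_add_ciInf fun h k => ?_
        rcases hC.total h.2 k.2 with hk | hk
        · exact (hCS k.2 i j).trans (by have : k.1 i ≤ h.1 i := hk i
                                        change k.1 i + k.1 j ≤ _
                                        linarith)
        · exact (hCS h.2 i j).trans (by have : h.1 j ≤ k.1 j := hk j
                                        change h.1 i + h.1 j ≤ _
                                        linarith)
      · intro h hh i
        exact ciInf_le (hbdd i) ⟨h, hh⟩) H hH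
    exact ⟨m, hmH, hm.1, fun h hS hle => hm.2 (y := OrderDual.toDual h) hS hle⟩
  refine ⟨m, hmH, hmS, fun i ε hε => ?_⟩
  by_contra! hcon
  -- Only half of ε, because the pair (i, i) loses the decrement twice.
  let m' : I → ℝ := Function.update m i (m i - ε / 2)
  have hm'S : ∀ a b, c a b ≤ m' a + m' b := by
    intro a b
    by_cases ha : a = i <;> by_cases hb : b = i
    · subst ha hb
      have := hcon b
      simp only [m', Function.update_self]
      linarith
    · subst ha
      have := hcon b
      simp only [m', Function.update_self, Function.update_of_ne hb]
      linarith
    · subst hb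
      have := hcon a
      rw [hc] at this
      simp only [m', Function.update_self, Function.update_of_ne ha]
      linarith
    · simpa only [m', Function.update_of_ne ha, Function.update_of_ne hb] using hmS a b
  have hle : m' ≤ m := by
    intro a
    by_cases ha : a = i
    · subst ha
      simp only [m', Function.update_self]
      linarith
    · simp [m', Function.update_of_ne ha]
  have h1 : m i ≤ m' i := hm m' hm'S hle i
  simp only [m', Function.update_self] at h1
  linarith

variable {X : Type u} [MetricSpace X]

/-- The metric forms that are tight on all the pairs on which `f` is tight. -/
def tightCell (f : X → ℝ) : Set (X → ℝ) :=
  {g | g ∈ metricForms X ∧ ∀ x y, f x + f y = dist x y → g x + g y = dist x y}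

/-- Every point has a partner at which `f` is tight. -/
def HasTightPartners (f : X → ℝ) : Prop := ∀ x, ∃ y, f x + f y = dist x y

theorem self_mem_tightCell {f : X → ℝ} (hf : f ∈ metricForms X) : f ∈ tightCell f :=
  ⟨hf, fun _ _ h => h⟩

theorem tightCell_subset {f g : X → ℝ} (hg : g ∈ tightCell f) : tightCell g ⊆ tightCell f :=
  fun _ hh => ⟨hh.1, fun x y hxy => hh.2 x y (hg.2 x y hxy)⟩

theorem HasTightPartners.of_mem_tightCell {f g : X → ℝ} (hf : HasTightPartners f)
    (hg : g ∈ tightCell f) : HasTightPartners g := fun x => by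
  obtain ⟨y, hy⟩ := hf x
  exact ⟨y, hg.2 x y hy⟩

theorem HasTightPartners.mem_extremalForms {f : X → ℝ} (hf : HasTightPartners f)
    (hm : f ∈ metricForms X) : f ∈ extremalForms X := by
  refine ⟨hm, fun g hg hle => ?_⟩
  funext x
  obtain ⟨y, hy⟩ := hf x
  have h1 := hg x y
  have h2 := hle x
  have h3 := hle y
  linarith

theorem nonneg_of_mem_metricForms {f : X → ℝ} (hf : f ∈ metricForms X) (x : X) : 0 ≤ f x := by
  have h := hf x x
  rw [dist_self] at h
  linarith

theorem le_dist_of_tight {f : X → ℝ} (hf : f ∈ metricForms X) {x y : X}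
    (h : f x + f y = dist x y) : f x ≤ dist x y := by
  have := nonneg_of_mem_metricForms hf y
  linarith

theorem convex_tightCell (f : X → ℝ) : Convex ℝ (tightCell f) := by
  intro g hg h hh a b ha hb hab
  refine ⟨fun x y => ?_, fun x y hxy => ?_⟩
  · have h1 := mul_le_mul_of_nonneg_left (hg.1 x y) ha
    have h2 := mul_le_mul_of_nonneg_left (hh.1 x y) hb
    have h3 : dist x y = a * dist x y + b * dist x y := by rw [← add_mul, hab, one_mul]
    simp only [Pi.add_apply, Pi.smul_apply, smul_eq_mul]
    linarith
  · have h1 := congrArg (a * ·) (hg.2 x y hxy)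
    have h2 := congrArg (b * ·) (hh.2 x y hxy)
    have h3 : dist x y = a * dist x y + b * dist x y := by rw [← add_mul, hab, one_mul]
    simp only [Pi.add_apply, Pi.smul_apply, smul_eq_mul] at h1 h2 ⊢
    linarith

theorem isCompact_tightCell {f : X → ℝ} (hf : HasTightPartners f) : IsCompact (tightCell f) := by
  choose p hp using hf
  have hclosed : IsClosed (tightCell f) := by
    simp only [tightCell, metricForms, ofPred_and, ofPred_forall]
    refine IsClosed.inter (isClosed_iInter fun x => isClosed_iInter fun y => ?_)
      (isClosed_iInter fun x => isClosed_iInter fun y => isClosed_iInter fun _ => ?_)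
    · exact isClosed_le (by fun_prop) (by fun_prop)
    · exact isClosed_eq (by fun_prop) (by fun_prop)
  refine (isCompact_univ_pi fun x => isCompact_Icc (a := (0 : ℝ)) (b := dist x (p x))).of_isClosed_subset
    hclosed fun g hg x _ => ⟨nonneg_of_mem_metricForms hg.1 x, le_dist_of_tight hg.1 (hg.2 _ _ (hp x))⟩

/-- `1`-Lipschitz maps to a cell extend. -/
theorem exists_lipschitz_extension_tightCell {f : X → ℝ} (hf : f ∈ metricForms X)
    (hfp : HasTightPartners f) {Y : Type w} [MetricSpace Y] (A : Set Y) (F : A → X → ℝ)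
    (hF : ∀ a, F a ∈ tightCell f) (hL : ∀ a b x, |F a x - F b x| ≤ dist a b) :
    ∃ g : Y → X → ℝ, (∀ y, g y ∈ tightCell f) ∧ (∀ y y' x, |g y x - g y' x| ≤ dist y y') ∧
      ∀ a : A, g a = F a := by
  rcases isEmpty_or_nonempty A with hA | hA
  · exact ⟨fun _ => f, fun _ => self_mem_tightCell hf, by simp, fun a => hA.elim a⟩
  have : Nonempty (tightCell f) := ⟨⟨f, self_mem_tightCell hf⟩⟩
  -- The sharpest lower bounds valid on the whole cell. Unlike `dist` in general, they satisfy
  -- `hc₀comp`, which is what makes a minimal solution tight.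
  let c₀ : X → X → ℝ := fun x x' => ⨅ g : tightCell f, (g.1 x + g.1 x')
  have hbdd : ∀ x x', BddBelow (range fun g : tightCell f => g.1 x + g.1 x') := fun x x' =>
    ⟨dist x x', by rintro _ ⟨g, rfl⟩; exact g.2.1 x x'⟩
  have hc₀le : ∀ g ∈ tightCell f, ∀ x x', c₀ x x' ≤ g x + g x' := fun g hg x x' =>
    ciInf_le (hbdd x x') ⟨g, hg⟩
  have hc₀ge : ∀ x x', dist x x' ≤ c₀ x x' := fun x x' => le_ciInf fun g => g.2.1 x x'
  have hc₀symm : ∀ x x', c₀ x x' = c₀ x' x := fun x x' => by simp only [c₀, add_comm]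
  have hc₀tight : ∀ x x', f x + f x' = dist x x' → c₀ x x' = dist x x' := fun x x' h =>
    le_antisymm ((hc₀le f (self_mem_tightCell hf) x x').trans h.le) (hc₀ge x x')
  have hc₀comp : ∀ x x' z w, f x + f x' = dist x x' →
      c₀ x z + c₀ x' w ≤ c₀ z w + dist x x' := by
    intro x x' z w h
    rw [← sub_le_iff_le_add]
    refine le_ciInf fun g => ?_
    have h1 := hc₀le g.1 g.2 x z
    have h2 := hc₀le g.1 g.2 x' w
    have h3 := g.2.2 x x' h
    linarith
  -- McShane's extension in each coordinate; it need not take values in the cell until it is lowered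
  -- to a minimal solution.
  let H : Y × X → ℝ := fun p => ⨅ a : A, (F a p.2 + dist (a : Y) p.1)
  have hHbdd : ∀ p : Y × X, BddBelow (range fun a : A => F a p.2 + dist (a : Y) p.1) := fun p =>
    ⟨0, by rintro _ ⟨a, rfl⟩; exact add_nonneg (nonneg_of_mem_metricForms (hF a).1 _) dist_nonneg⟩
  obtain ⟨m, hmH, hm, hmin⟩ := exists_minimal_le_of_add_ge
    (fun p q : Y × X => c₀ p.2 q.2 - dist p.1 q.1)
    (fun p q => by rw [hc₀symm, dist_comm]) H (by
      rintro ⟨y, x⟩ ⟨y', x'⟩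
      refine le_ciInf_add_ciInf fun a b => ?_
      have h1 := hc₀le (F a) (hF a) x x'
      have h2 := (abs_le.1 (hL a b x')).2
      have h3 : dist (a : Y) b ≤ dist (a : Y) y + dist y y' + dist (b : Y) y' := by
        rw [dist_comm (b : Y) y']
        exact dist_triangle4 _ _ _ _
      rw [Subtype.dist_eq] at h2
      dsimp only
      linarith)
  have htight : ∀ y x x', f x + f x' = dist x x' → m (y, x) + m (y, x') = dist x x' := by
    intro y x x' h
    refine le_antisymm (le_of_forall_pos_le_add fun ε hε => ?_) ?_
    -- Add the two almost tight inequalities, then bound m (z, s) + m (w, t) from below by the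
    -- system and c₀ x s + c₀ x' t from above by `hc₀comp`.
    · obtain ⟨⟨z, s⟩, hs⟩ := hmin (y, x) (ε / 2) (half_pos hε)
      obtain ⟨⟨w, t⟩, ht⟩ := hmin (y, x') (ε / 2) (half_pos hε)
      have h1 := hc₀comp x x' s t h
      have h2 := hm (z, s) (w, t)
      have h3 := dist_triangle_left z w y
      dsimp only at hs ht h2
      linarith
    · have h1 := hm (y, x) (y, x')
      dsimp only at h1
      rw [dist_self, hc₀tight x x' h] at h1
      linarith
  have hcell : ∀ y, (fun x => m (y, x)) ∈ tightCell f := fun y =>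
    ⟨fun x x' => by
      have h1 := hm (y, x) (y, x')
      have h2 := hc₀ge x x'
      dsimp only at h1
      rw [dist_self] at h1
      linarith, htight y⟩
  have hlip : ∀ y y' x, m (y, x) ≤ m (y', x) + dist y y' := by
    intro y y' x
    obtain ⟨x', hx'⟩ := hfp x
    have h1 := htight y x x' hx'
    have h2 := hm (y', x) (y, x')
    dsimp only at h2
    rw [hc₀tight x x' hx', dist_comm y' y] at h2
    linarith
  refine ⟨fun y x => m (y, x), hcell, fun y y' x => abs_le.2 ⟨?_, ?_⟩, fun a => ?_⟩
  · have := hlip y' y x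
    rw [dist_comm] at this
    linarith
  · linarith [hlip y y' x]
  -- Over a ∈ A the solution lies below H, hence below F a, which is extremal.
  · refine ((hfp.of_mem_tightCell (hF a)).mem_extremalForms (hF a).1).2 _ (hcell a).1 fun x => ?_
    refine (hmH (a, x)).trans ((ciInf_le (hHbdd (a, x)) a).trans ?_)
    simp

/-- The functions along which the cell of `f` extends. -/
def tightSpace (f : X → ℝ) : Submodule ℝ (X → ℝ) where
  carrier := {g | ∀ x y, f x + f y = dist x y → g x + g y = 0}
  add_mem' {a b} ha hb x y h := by
    have h1 := ha x y h
    have h2 := hb x y h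
    simp only [Pi.add_apply]
    linarith
  zero_mem' x y _ := by simp
  smul_mem' r a ha x y h := by
    simp only [Pi.smul_apply, smul_eq_mul, ← mul_add, ha x y h, mul_zero]

theorem sub_mem_tightSpace {f g h : X → ℝ} (hg : g ∈ tightCell f) (hh : h ∈ tightCell f) :
    g - h ∈ tightSpace f := fun x y hxy => by
  have h1 := hg.2 x y hxy
  have h2 := hh.2 x y hxy
  simp only [Pi.sub_apply]
  linarith

end TightCells

/-! ### Discrete Helly spaces: reduction to small coordinates. -/

/-- A nonempty metric space with integral distances and finite balls, in which pairwise intersecting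
families of balls with integral radii have a common point. -/
structure IsDiscreteHelly (X : Type u) [MetricSpace X] : Prop where
  nonempty : Nonempty X
  dist_integral : ∀ x y : X, ∃ n : ℤ, dist x y = n
  finite_closedBall : ∀ (x : X) (R : ℝ), (Metric.closedBall x R).Finite
  helly : ∀ r : X → ℤ, (∀ x y, dist x y ≤ r x + r y) → ∃ z, ∀ x, dist z x ≤ r x

section Extremal

variable {X : Type u} [MetricSpace X] {f g : X → ℝ}

theorem exists_add_lt_of_extremal (hf : f ∈ extremalForms X) (x : X) {ε : ℝ} (hε : 0 < ε) :
    ∃ y, f x + f y < dist x y + ε := by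
  obtain ⟨m, hmf, hm, hmin⟩ := exists_minimal_le_of_add_ge (fun x y : X => dist x y) dist_comm f hf.1
  obtain rfl := hf.2 m hm hmf
  exact hmin x ε hε

theorem le_add_dist_of_extremal (hf : f ∈ extremalForms X) (x y : X) : f y ≤ f x + dist x y :=
  InjectiveHull.le_add_dist ⟨f, hf⟩ x y

end Extremal

namespace IsDiscreteHelly

variable {X : Type u} [MetricSpace X] {f g h : X → ℝ}

/-- Rounding f up gives admissible integral radii. A common point v has d(v, y) < f y + 1 for all y,
and an almost tight partner of v bounds f v. -/
theorem exists_le_one (hX : IsDiscreteHelly X) (hf : f ∈ extremalForms X) : ∃ v, f v ≤ 1 := by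
  obtain ⟨v, hv⟩ := hX.helly (fun x => ⌈f x⌉) fun x y => by
    have := hf.1 x y
    have h1 := Int.le_ceil (f x)
    have h2 := Int.le_ceil (f y)
    linarith
  refine ⟨v, le_of_forall_pos_le_add fun ε hε => ?_⟩
  obtain ⟨y, hy⟩ := exists_add_lt_of_extremal hf v hε
  have h1 := hv y
  have h2 := Int.ceil_lt_add_one (f y)
  linarith

/-- Every value of an extremal form is determined by its values on the points where it is small. -/
theorem exists_eq_add_dist (hX : IsDiscreteHelly X) (hf : f ∈ extremalForms X) (x : X) :
    ∃ z, f z < 3 / 2 ∧ f x = f z + dist x z := by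
  classical
  have hnn := nonneg_of_mem_metricForms hf.1
  rcases lt_or_ge (f x) (1 / 2) with hx | hx
  · exact ⟨x, by linarith, by simp⟩
  -- The largest integer with f x - k ≥ 1/2. For a, b ≠ x the two floors below lose less than 2, and
  -- 2 (f x - k) ≥ 1 is gained, so the radii add up to more than d(a, b) - 1; integrality gives d(a,
  -- b).
  let k : ℤ := ⌊f x - 1 / 2⌋
  have hk0 : 0 ≤ k := Int.floor_nonneg.2 (by linarith)
  have hk0' : (0 : ℝ) ≤ k := by exact_mod_cast hk0
  have hk1 : (k : ℝ) ≤ f x - 1 / 2 := Int.floor_le _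
  have hk2 : f x - 1 / 2 < k + 1 := Int.lt_floor_add_one _
  have hfl : ∀ y, dist x y ≤ ⌊f y + f x⌋ := by
    intro y
    obtain ⟨n, hn⟩ := hX.dist_integral x y
    rw [hn]
    have : (n : ℝ) ≤ f y + f x := by rw [← hn, add_comm]; exact hf.1 x y
    exact_mod_cast Int.le_floor.2 this
  obtain ⟨z, hz⟩ := hX.helly (fun y => if y = x then k else ⌊f y + f x⌋ - k) (by
    intro a b
    by_cases ha : a = x <;> by_cases hb : b = x
    · rw [if_pos ha, if_pos hb, ha, hb, dist_self]
      linarith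
    · rw [if_pos ha, if_neg hb, ha]
      push_cast
      linarith [hfl b]
    · rw [if_neg ha, if_pos hb, hb, dist_comm]
      push_cast
      linarith [hfl a]
    · rw [if_neg ha, if_neg hb]
      obtain ⟨n, hn⟩ := hX.dist_integral a b
      have h1 := Int.lt_floor_add_one (f a + f x)
      have h2 := Int.lt_floor_add_one (f b + f x)
      have h3 := hf.1 a b
      rw [hn] at h3 ⊢
      have h4 : (n : ℝ) < ((⌊f a + f x⌋ - k + (⌊f b + f x⌋ - k) + 1 : ℤ) : ℝ) := by
        push_cast
        linarith
      have h5 : n ≤ ⌊f a + f x⌋ - k + (⌊f b + f x⌋ - k) := Int.lt_add_one_iff.1 (by exact_mod_cast h4)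
      exact_mod_cast h5)
  have hzx : dist z x ≤ k := by simpa using hz x
  have hzy : ∀ y, dist z y ≤ f y + f x - k := by
    intro y
    by_cases hy : y = x
    · rw [hy]
      linarith
    · have h1 := hz y
      rw [if_neg hy] at h1
      push_cast at h1
      have h2 := Int.floor_le (f y + f x)
      linarith
  have hfz : f z ≤ f x - k := by
    refine le_of_forall_pos_le_add fun ε hε => ?_
    obtain ⟨y, hy⟩ := exists_add_lt_of_extremal hf z hε
    linarith [hzy y]
  refine ⟨z, by linarith, ?_⟩
  have h1 := le_add_dist_of_extremal hf z x
  rw [dist_comm x z]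
  linarith

theorem finite_setOf_le (hX : IsDiscreteHelly X) (hf : f ∈ metricForms X) (R : ℝ) :
    {z | f z ≤ R}.Finite := by
  obtain ⟨v⟩ := hX.nonempty
  refine (hX.finite_closedBall v (R + f v)).subset fun z hz => ?_
  have h1 := hf z v
  have h2 : f z ≤ R := hz
  rw [Metric.mem_closedBall]
  linarith

theorem exists_pos_le_of_pos_add_int (a : ℝ) : ∃ δ > 0, ∀ m : ℤ, 0 < a + m → δ ≤ a + m := by
  refine ⟨a - (⌈a⌉ - 1), by linarith [Int.ceil_lt_add_one a], fun m hm => ?_⟩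
  have h1 : -m < ⌈a⌉ := Int.lt_ceil.2 (by push_cast; linarith)
  have h2 : -m ≤ ⌈a⌉ - 1 := by omega
  have h3 : ((-m : ℤ) : ℝ) ≤ ((⌈a⌉ - 1 : ℤ) : ℝ) := by exact_mod_cast h2
  push_cast at h3
  linarith

/-- Modulo ℤ, the slack of (x, y) equals f z + f w with z, w in the finite set where f ≤ 3/2, and
the positive elements of a class a + ℤ have a least one. -/
theorem exists_gap (hX : IsDiscreteHelly X) (hf : f ∈ extremalForms X) :
    ∃ δ > 0, ∀ x y, dist x y < f x + f y → dist x y + δ ≤ f x + f y := by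
  let Z : Set X := {z | f z ≤ 3 / 2}
  have hZ : Z.Finite := hX.finite_setOf_le hf.1 _
  choose δ hδ0 hδ using fun p : X × X => exists_pos_le_of_pos_add_int (f p.1 + f p.2)
  obtain ⟨v, hv⟩ := hX.exists_le_one hf
  have hvZ : v ∈ Z := by
    change f v ≤ 3 / 2
    linarith
  obtain ⟨p, hp, hmin⟩ := Set.exists_min_image (Z ×ˢ Z) δ (hZ.prod hZ) ⟨(v, v), hvZ, hvZ⟩
  refine ⟨δ p, hδ0 p, fun x y hxy => ?_⟩
  obtain ⟨z, hz, hxz⟩ := hX.exists_eq_add_dist hf x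
  obtain ⟨w, hw, hyw⟩ := hX.exists_eq_add_dist hf y
  have h1 := hmin (z, w) ⟨hz.le, hw.le⟩
  obtain ⟨a, ha⟩ := hX.dist_integral x z
  obtain ⟨b, hb⟩ := hX.dist_integral y w
  obtain ⟨c, hc⟩ := hX.dist_integral x y
  have h2 := hδ (z, w) (a + b - c) (by push_cast; linarith)
  push_cast at h2
  linarith

theorem hasTightPartners (hX : IsDiscreteHelly X) (hf : f ∈ extremalForms X) :
    HasTightPartners f := by
  intro x
  obtain ⟨δ, hδ, hgap⟩ := hX.exists_gap hf
  obtain ⟨y, hy⟩ := exists_add_lt_of_extremal hf x hδ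
  refine ⟨y, ((hf.1 x y).eq_or_lt.resolve_right fun h => ?_).symm⟩
  linarith [hgap x y h]

theorem tightCell_subset_extremalForms (hX : IsDiscreteHelly X) (hf : f ∈ extremalForms X) :
    tightCell f ⊆ extremalForms X := fun _ hg =>
  ((hX.hasTightPartners hf).of_mem_tightCell hg).mem_extremalForms hg.1

/-- The coordinates on the cell of `f` which only take values in `[0, 2]`. -/
def _root_.smallCoords (f : X → ℝ) : Set X := {z | ∀ g ∈ tightCell f, g z ≤ 2}

theorem finite_smallCoords (hX : IsDiscreteHelly X) (hf : f ∈ extremalForms X) :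
    (smallCoords f).Finite :=
  (hX.finite_setOf_le hf.1 2).subset fun _ hz => hz f (self_mem_tightCell hf.1)

/-- Let y be a tight partner of x, and reduce x and y to z and w. Then f is tight on (z, y) and (z,
w). The integer d(z, w) = f z + f w is below 3, so it bounds the coordinate z by 2 on the cell; the
common partner y ties the coordinates x and z together. -/
theorem exists_mem_smallCoords (hX : IsDiscreteHelly X) (hf : f ∈ extremalForms X) (x : X) :
    ∃ z ∈ smallCoords f, (∀ g ∈ tightCell f, g x = g z + dist x z) ∧
      ∀ u ∈ tightSpace f, u x = u z := by
  obtain ⟨y, hy⟩ := hX.hasTightPartners hf x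
  obtain ⟨z, hz, hxz⟩ := hX.exists_eq_add_dist hf x
  obtain ⟨w, hw, hyw⟩ := hX.exists_eq_add_dist hf y
  have hzy : f z + f y = dist z y :=
    le_antisymm (by linarith [dist_triangle x z y]) (hf.1 z y)
  have hzw : f z + f w = dist z w := by
    refine le_antisymm ?_ (hf.1 z w)
    have := dist_triangle z w y
    rw [dist_comm w y] at this
    linarith
  refine ⟨z, fun g hg => ?_, fun g hg => ?_, fun u hu => ?_⟩
  · refine (le_dist_of_tight hg.1 (hg.2 z w hzw)).trans ?_
    obtain ⟨n, hn⟩ := hX.dist_integral z w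
    have h3 : (n : ℝ) < ((2 + 1 : ℤ) : ℝ) := by
      push_cast
      linarith
    have h4 : n ≤ 2 := Int.lt_add_one_iff.1 (by exact_mod_cast h3)
    rw [hn]
    exact_mod_cast h4
  · have h1 := hg.2 x y hy
    have h2 := hg.2 z y hzy
    linarith
  · have h1 := hu x y hy
    have h2 := hu z y hzy
    linarith

theorem exists_abs_sub_eq (hX : IsDiscreteHelly X) (hf : f ∈ extremalForms X)
    (hg : g ∈ tightCell f) (hh : h ∈ tightCell f) (x : X) :
    ∃ z ∈ smallCoords f, |g x - h x| = |g z - h z| := by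
  obtain ⟨z, hz, -, hu⟩ := hX.exists_mem_smallCoords hf x
  refine ⟨z, hz, ?_⟩
  have := hu _ (sub_mem_tightSpace hg hh)
  simp only [Pi.sub_apply] at this
  rw [this]

theorem abs_sub_le_two (hX : IsDiscreteHelly X) (hf : f ∈ extremalForms X)
    (hg : g ∈ tightCell f) (hh : h ∈ tightCell f) (x : X) : |g x - h x| ≤ 2 := by
  obtain ⟨z, hz, hu⟩ := hX.exists_abs_sub_eq hf hg hh x
  rw [hu, abs_le]
  have h1 := hz g hg
  have h2 := hz h hh
  have h3 := nonneg_of_mem_metricForms hg.1 z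
  have h4 := nonneg_of_mem_metricForms hh.1 z
  constructor <;> linarith

/-- An extremal form lies in the relative interior of its cell. -/
theorem exists_add_smul_mem_tightCell (hX : IsDiscreteHelly X) (hf : f ∈ extremalForms X)
    {u : X → ℝ} (hu : u ∈ tightSpace f) :
    ∃ ε > 0, ∀ t : ℝ, |t| ≤ ε → f + t • u ∈ tightCell f := by
  obtain ⟨δ, hδ, hgap⟩ := hX.exists_gap hf
  obtain ⟨M, hM⟩ := ((hX.finite_smallCoords hf).image fun z => |u z|).bddAbove
  have hM' : ∀ x, |u x| ≤ M := fun x => by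
    obtain ⟨z, hz, -, h⟩ := hX.exists_mem_smallCoords hf x
    rw [h u hu]
    exact hM (mem_image_of_mem _ hz)
  obtain ⟨v⟩ := hX.nonempty
  have hM0 : 0 ≤ M := (abs_nonneg _).trans (hM' v)
  refine ⟨δ / (2 * M + 1), by positivity, fun t ht => ?_⟩
  have htu : ∀ x, -(δ / 2) ≤ t * u x := by
    intro x
    have h1 : |t * u x| ≤ δ / (2 * M + 1) * M := by
      rw [abs_mul]
      exact mul_le_mul ht (hM' x) (abs_nonneg _) (by positivity)
    have h2 : δ / (2 * M + 1) * M ≤ δ / 2 := by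
      rw [div_mul_eq_mul_div, div_le_div_iff₀ (by positivity) two_pos]
      nlinarith
    linarith [(abs_le.1 h1).1]
  have htight : ∀ x y, f x + f y = dist x y → (f + t • u) x + (f + t • u) y = dist x y := by
    intro x y h
    have h1 := congrArg (t * ·) (hu x y h)
    simp only [Pi.add_apply, Pi.smul_apply, smul_eq_mul] at h1 ⊢
    linarith
  refine ⟨fun x y => ?_, htight⟩
  rcases (hf.1 x y).eq_or_lt with h | h
  · exact (htight x y h.symm).ge
  · have h1 := hgap x y h
    have h2 := htu x
    have h3 := htu y
    simp only [Pi.add_apply, Pi.smul_apply, smul_eq_mul]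
    linarith

/-! ### Extreme points and finiteness of cells. -/

/-- If f x + f y is an integer, then sin (2π f x) and sin (2π f y) cancel. So sin (2π f) lies in the
tight space and must vanish. -/
theorem exists_eq_int_div_two (hX : IsDiscreteHelly X)
    (hbot : tightSpace f = ⊥) (x : X) : ∃ n : ℤ, f x = n / 2 := by
  have hu : (fun x => Real.sin (2 * Real.pi * f x)) ∈ tightSpace f := by
    intro x y hxy
    obtain ⟨n, hn⟩ := hX.dist_integral x y
    have : f y = n - f x := by linarith
    dsimp only
    rw [this, mul_sub, show 2 * Real.pi * (n : ℝ) - 2 * Real.pi * f x =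
      -(2 * Real.pi * f x) + n * (2 * Real.pi) by ring, Real.sin_add_int_mul_two_pi, Real.sin_neg]
    ring
  rw [hbot, Submodule.mem_bot] at hu
  obtain ⟨n, hn⟩ := Real.sin_eq_zero_iff.1 (congrFun hu x)
  refine ⟨n, ?_⟩
  have hpi := Real.pi_ne_zero
  field_simp at hn
  linarith

theorem tightSpace_eq_bot_of_mem_extremePoints (hX : IsDiscreteHelly X)
    (hf : f ∈ extremalForms X) (hg : g ∈ (tightCell f).extremePoints ℝ) : tightSpace g = ⊥ := by
  rw [eq_bot_iff]
  intro u hu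
  rw [mem_extremePoints] at hg
  obtain ⟨ε, hε, h⟩ :=
    hX.exists_add_smul_mem_tightCell (hX.tightCell_subset_extremalForms hf hg.1) hu
  have h1 := tightCell_subset hg.1 (h ε (abs_of_pos hε).le)
  have h2 := tightCell_subset hg.1 (h (-ε) (by rw [abs_neg, abs_of_pos hε]))
  have h3 := (hg.2 _ h1 _ h2 ⟨1 / 2, 1 / 2, by norm_num, by norm_num, by norm_num, by module⟩).1
  rw [add_eq_left, smul_eq_zero] at h3
  exact h3.resolve_left hε.ne'

/-- The extremal forms with half-integral values and with a bounded value at `v`. -/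
def _root_.halfIntegralForms (v : X) (R : ℝ) : Set (X → ℝ) :=
  {h | h ∈ extremalForms X ∧ h v ≤ R ∧ ∀ x, ∃ n : ℤ, h x = n / 2}

theorem finite_half_integers (K : ℝ) : {r : ℝ | 0 ≤ r ∧ r ≤ K ∧ ∃ n : ℤ, r = n / 2}.Finite := by
  refine ((Set.finite_Icc (0 : ℤ) ⌊2 * K⌋).image fun n : ℤ => (n : ℝ) / 2).subset ?_
  rintro r ⟨h0, hK, n, rfl⟩
  refine ⟨n, ⟨?_, Int.le_floor.2 (by linarith)⟩, rfl⟩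
  have : (0 : ℝ) ≤ n := by linarith
  exact_mod_cast this

/-- Each form h here is determined by its values on a finite ball: the points z with h z < 3/2
satisfy d(z, v) ≤ h z + h v ≤ R + 3/2. Another form k agreeing with h on that ball satisfies k ≤ h,
hence k = h. -/
theorem finite_halfIntegralForms (hX : IsDiscreteHelly X) (v : X) (R : ℝ) :
    (halfIntegralForms v R).Finite := by
  let B := Metric.closedBall v (R + 3 / 2)
  have hB : B.Finite := hX.finite_closedBall v _
  have : Finite B := hB
  refine Set.Finite.of_finite_image (f := fun (h : X → ℝ) (b : B) => h b) ?_ ?_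
  · refine (Set.Finite.pi' fun _ : B => finite_half_integers (R + (R + 3 / 2))).subset ?_
    rintro _ ⟨h, ⟨hh, hR, hn⟩, rfl⟩ ⟨b, hb⟩
    refine ⟨nonneg_of_mem_metricForms hh.1 b, ?_, hn b⟩
    have h1 := le_add_dist_of_extremal hh v b
    have h2 : dist b v ≤ R + 3 / 2 := hb
    rw [dist_comm] at h2
    dsimp only
    linarith
  · rintro h ⟨hh, hR, -⟩ k ⟨hk, -, -⟩ hhk
    refine (hh.2 k hk.1 fun x => ?_).symm
    obtain ⟨z, hz, hxz⟩ := hX.exists_eq_add_dist hh x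
    have hzB : z ∈ B := by
      rw [Metric.mem_closedBall]
      linarith [hh.1 z v]
    have h1 := congrFun hhk ⟨z, hzB⟩
    dsimp only at h1
    have h2 := le_add_dist_of_extremal hk z x
    rw [dist_comm] at h2
    linarith

theorem extremePoints_subset_halfIntegralForms (hX : IsDiscreteHelly X)
    (hf : f ∈ extremalForms X) (hg : g ∈ tightCell f) {v : X} {R : ℝ} (hR : g v ≤ R) :
    (tightCell f).extremePoints ℝ ⊆ halfIntegralForms v (R + 2) := by
  intro h hh
  have hhE := hX.tightCell_subset_extremalForms hf hh.1
  refine ⟨hhE, ?_,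
    hX.exists_eq_int_div_two (hX.tightSpace_eq_bot_of_mem_extremePoints hf hh)⟩
  have := (abs_le.1 (hX.abs_sub_le_two hf hg hh.1 v)).1
  linarith

theorem finite_extremePoints (hX : IsDiscreteHelly X) (hf : f ∈ extremalForms X) :
    ((tightCell f).extremePoints ℝ).Finite := by
  obtain ⟨v⟩ := hX.nonempty
  exact (hX.finite_halfIntegralForms v _).subset
    (hX.extremePoints_subset_halfIntegralForms hf (self_mem_tightCell hf.1) le_rfl)

/-- Krein–Milman in the product topology; the closure is superfluous for finitely many extreme
points. -/
theorem convexHull_extremePoints (hX : IsDiscreteHelly X) (hf : f ∈ extremalForms X) :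
    convexHull ℝ ((tightCell f).extremePoints ℝ) = tightCell f := by
  conv_rhs => rw [← closure_convexHull_extremePoints
    (isCompact_tightCell (hX.hasTightPartners hf)) (convex_tightCell f)]
  exact ((hX.finite_extremePoints hf).isClosed_convexHull ℝ).closure_eq.symm

/-- A cell is recovered from its extreme points. As coordinates vary by at most 2 on a cell, these
belong to the finite set `halfIntegralForms v (R + 2)`. -/
theorem finite_setOf_tightCell (hX : IsDiscreteHelly X) (v : X) (R : ℝ) :
    {C : Set (X → ℝ) | (∃ f ∈ extremalForms X, C = tightCell f) ∧ ∃ g ∈ C, g v ≤ R}.Finite := by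
  refine (((hX.finite_halfIntegralForms v (R + 2)).finite_subsets).image (convexHull ℝ)).subset ?_
  rintro _ ⟨⟨f, hf, rfl⟩, g, hg, hR⟩
  exact ⟨_, hX.extremePoints_subset_halfIntegralForms hf hg hR, hX.convexHull_extremePoints hf⟩

end IsDiscreteHelly

/-! ### The polyhedral complex: faces, intersections, coordinates. -/

namespace IsDiscreteHelly

variable {X : Type u} [MetricSpace X] {f g h : X → ℝ}

theorem isPolytope_tightCell (hX : IsDiscreteHelly X) (hf : f ∈ extremalForms X) :
    IsPolytope (tightCell f) := by
  refine ⟨_, hX.finite_extremePoints hf, ?_, (hX.convexHull_extremePoints hf).symm⟩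
  rw [← convexHull_nonempty_iff (𝕜 := ℝ), hX.convexHull_extremePoints hf]
  exact ⟨f, self_mem_tightCell hf.1⟩

/-- Existence of a generic point of F. Only finitely many cells arise from points of F, so some f₁
has a maximal one. The midpoint of f₁ and h is tight only where both are, so its cell contains h and
the cell of f₁; by maximality h lies in the latter. -/
theorem exists_mem_forall_mem_tightCell (hX : IsDiscreteHelly X) (hf : f ∈ extremalForms X)
    {F : Set (X → ℝ)} (hF : F ⊆ tightCell f) (hne : F.Nonempty) (hconv : Convex ℝ F) :
    ∃ f₁ ∈ F, F ⊆ tightCell f₁ := by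
  obtain ⟨v⟩ := hX.nonempty
  have hE := hF.trans (hX.tightCell_subset_extremalForms hf)
  have hfin : (tightCell '' F).Finite := by
    refine (hX.finite_setOf_tightCell v (f v + 2)).subset ?_
    rintro _ ⟨g, hg, rfl⟩
    refine ⟨⟨g, hE hg, rfl⟩, g, self_mem_tightCell (hE hg).1, ?_⟩
    have := (abs_le.1 (hX.abs_sub_le_two hf (hF hg) (self_mem_tightCell hf.1) v)).2
    linarith
  obtain ⟨_, ⟨⟨f₁, hf₁, rfl⟩, hmax⟩⟩ := hfin.exists_maximal (hne.image _)
  refine ⟨f₁, hf₁, fun h hh => ?_⟩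
  let m : X → ℝ := (1 / 2 : ℝ) • f₁ + (1 / 2 : ℝ) • h
  have hmF : m ∈ F := hconv hf₁ hh (by norm_num) (by norm_num) (by norm_num)
  have hm : ∀ x, m x = (f₁ x + h x) / 2 := fun x => by
    simp only [m, Pi.add_apply, Pi.smul_apply, smul_eq_mul]
    ring
  have key : f₁ ∈ tightCell m ∧ h ∈ tightCell m := by
    refine ⟨⟨(hE hf₁).1, fun x y hxy => ?_⟩, (hE hh).1, fun x y hxy => ?_⟩ <;>
    · rw [hm, hm] at hxy
      have h1 := (hE hf₁).1 x y
      have h2 := (hE hh).1 x y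
      linarith
  exact hmax (mem_image_of_mem _ hmF) (tightCell_subset key.1) key.2

/-- The face is cut out by minimizing the sum of h z + h w over the pairs of small coordinates on
which g is tight. Each term is at least d(z, w), so a minimizer is tight on all these pairs, and
this propagates to every pair reduced to them. -/
theorem isFace_tightCell (hX : IsDiscreteHelly X) (hf : f ∈ extremalForms X)
    (hg : g ∈ tightCell f) : IsFace (tightCell f) (tightCell g) := by
  classical
  let Z := (hX.finite_smallCoords hf).toFinset
  let P : Finset (X × X) := (Z ×ˢ Z).filter fun p => g p.1 + g p.2 = dist p.1 p.2
  let l : (X → ℝ) →ₗ[ℝ] ℝ := 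
    -∑ p ∈ P, ((LinearMap.proj p.1 : (X → ℝ) →ₗ[ℝ] ℝ) + (LinearMap.proj p.2 : (X → ℝ) →ₗ[ℝ] ℝ))
  have hl : ∀ h : X → ℝ, l h = -∑ p ∈ P, (h p.1 + h p.2) := fun h => by
    simp [l, LinearMap.sum_apply]
  have hP : ∀ p ∈ P, g p.1 + g p.2 = dist p.1 p.2 := fun p hp => (Finset.mem_filter.1 hp).2
  have hle : ∀ h ∈ metricForms X, ∀ p ∈ P, g p.1 + g p.2 ≤ h p.1 + h p.2 := fun h hh p hp =>
    (hP p hp).trans_le (hh p.1 p.2)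
  refine ⟨l, Set.ext fun h => ⟨fun hh => ⟨tightCell_subset hg hh, fun k hk => ?_⟩, ?_⟩⟩
  · rw [hl, hl, neg_le_neg_iff]
    refine Finset.sum_le_sum fun p hp => ?_
    rw [hh.2 _ _ (hP p hp)]
    exact hk.1 _ _
  · rintro ⟨hh, hmax⟩
    refine ⟨hh.1, fun x y hxy => ?_⟩
    have hsum : ∑ p ∈ P, (h p.1 + h p.2) ≤ ∑ p ∈ P, (g p.1 + g p.2) := by
      have := hmax g hg
      rwa [hl, hl, neg_le_neg_iff] at this
    have heq := (Finset.sum_eq_sum_iff_of_le (hle h hh.1)).1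
      (le_antisymm (Finset.sum_le_sum (hle h hh.1)) hsum)
    obtain ⟨z, hz, hgz, -⟩ := hX.exists_mem_smallCoords hf x
    obtain ⟨w, hw, hgw, -⟩ := hX.exists_mem_smallCoords hf y
    have hzw : g z + g w = dist z w := by
      refine le_antisymm ?_ (hg.1 z w)
      have h1 := dist_triangle4 x z w y
      rw [dist_comm w y] at h1
      linarith [hgz g hg, hgw g hg]
    have h1 := heq (z, w) (by simp [P, Z, hz, hw, hzw])
    dsimp only at h1
    linarith [hgz g hg, hgw g hg, hgz h hh, hgw h hh]

theorem exists_eq_tightCell_of_isFace (hX : IsDiscreteHelly X) (hf : f ∈ extremalForms X)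
    {F : Set (X → ℝ)} (hF : IsFace (tightCell f) F) : ∃ f₁ ∈ extremalForms X, F = tightCell f₁ := by
  obtain ⟨l, rfl⟩ := hF
  obtain ⟨S, hS, hSne, hSC⟩ := hX.isPolytope_tightCell hf
  obtain ⟨s, hs, hmax⟩ := Set.exists_min_image S (fun s => -l s) hS hSne
  have hmax' : ∀ y ∈ tightCell f, l y ≤ l s := by
    rw [hSC]
    exact convexHull_min (fun y hy => neg_le_neg_iff.1 (hmax y hy))
      (convex_halfSpace_le l.isLinear (l s))
  have hsC : s ∈ tightCell f := hSC ▸ subset_convexHull ℝ S hs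
  obtain ⟨f₁, ⟨hf₁, hf₁max⟩, hsub⟩ := hX.exists_mem_forall_mem_tightCell hf
    (F := {x | x ∈ tightCell f ∧ ∀ y ∈ tightCell f, l y ≤ l x}) (fun _ hx => hx.1)
    ⟨s, hsC, hmax'⟩ (by
      intro x hx y hy a b ha hb hab
      refine ⟨convex_tightCell f hx.1 hy.1 ha hb hab, fun z hz => ?_⟩
      have h1 := mul_le_mul_of_nonneg_left (hx.2 z hz) ha
      have h2 := mul_le_mul_of_nonneg_left (hy.2 z hz) hb
      have h3 : l z = a * l z + b * l z := by rw [← add_mul, hab, one_mul]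
      simp only [map_add, map_smul, smul_eq_mul]
      linarith)
  have hf₁E := hX.tightCell_subset_extremalForms hf hf₁
  refine ⟨f₁, hf₁E, hsub.antisymm fun h hh => ⟨tightCell_subset hf₁ hh, fun y hy => ?_⟩⟩
  -- The segment from h to f₁ can be prolonged beyond f₁. Since l is maximal at f₁, it cannot be
  -- smaller at h.
  obtain ⟨ε, hε, hmem⟩ := hX.exists_add_smul_mem_tightCell hf₁E
    (sub_mem_tightSpace (self_mem_tightCell hf₁E.1) hh)
  have h1 := hf₁max _ (tightCell_subset hf₁ (hmem ε (abs_of_pos hε).le))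
  rw [map_add, map_smul, map_sub, smul_eq_mul] at h1
  have h2 : l f₁ - l h ≤ 0 := nonpos_of_mul_nonpos_right (by linarith) hε
  linarith [hf₁max y hy]

theorem isFace_inter (hX : IsDiscreteHelly X) (hf : f ∈ extremalForms X)
    (hne : (tightCell f ∩ tightCell g).Nonempty) :
    IsFace (tightCell f) (tightCell f ∩ tightCell g) := by
  obtain ⟨f₁, hf₁, hsub⟩ := hX.exists_mem_forall_mem_tightCell hf inter_subset_left hne
    ((convex_tightCell f).inter (convex_tightCell g))
  rw [hsub.antisymm (subset_inter (tightCell_subset hf₁.1) (tightCell_subset hf₁.2))]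
  exact hX.isFace_tightCell hf hf₁.1

/-- The cells `tightCell f`, for `f ∈ E(X)`, form a polyhedral complex. -/
def hullComplex (hX : IsDiscreteHelly X) : PolyhedralComplex (X → ℝ) where
  cells := {C | ∃ f ∈ extremalForms X, C = tightCell f}
  isPolytope := by
    rintro _ ⟨f, hf, rfl⟩
    exact hX.isPolytope_tightCell hf
  face_mem := by
    rintro _ ⟨f, hf, rfl⟩ F hF
    exact hX.exists_eq_tightCell_of_isFace hf hF
  inter_isFace := by
    rintro _ ⟨f, hf, rfl⟩ _ ⟨g, hg, rfl⟩ hne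
    refine ⟨hX.isFace_inter hf hne, ?_⟩
    rw [inter_comm] at hne ⊢
    exact hX.isFace_inter hg hne

theorem vectorSpan_tightCell (hX : IsDiscreteHelly X) (hf : f ∈ extremalForms X) :
    vectorSpan ℝ (tightCell f) = tightSpace f := by
  refine le_antisymm (Submodule.span_le.2 ?_) fun u hu => ?_
  · rintro _ ⟨g, hg, h, hh, rfl⟩
    exact sub_mem_tightSpace hg hh
  · obtain ⟨ε, hε, hmem⟩ := hX.exists_add_smul_mem_tightCell hf hu
    have h1 := vsub_mem_vectorSpan ℝ (hmem ε (abs_of_pos hε).le) (self_mem_tightCell hf.1)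
    rw [vsub_eq_sub, add_sub_cancel_left] at h1
    simpa [smul_smul, hε.ne'] using (vectorSpan ℝ (tightCell f)).smul_mem ε⁻¹ h1

/-- The cell of `f` is parametrized by `dim` many small coordinates, any other coordinate being,
up to sign and an additive constant, one of these or else constant. -/
theorem exists_coordinates (hX : IsDiscreteHelly X) (hf : f ∈ extremalForms X) :
    ∃ σ : Fin (polytopeDim (tightCell f)) → X, (∀ i, σ i ∈ smallCoords f) ∧
      ∀ u ∈ tightSpace f, ∀ x, u x = 0 ∨ ∃ i, |u x| = |u (σ i)| := by
  classical
  -- On the tight space, tight partners have opposite values, so they are equivalent.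
  let s : Setoid X :=
    { r x y := ∀ u ∈ tightSpace f, |u x| = |u y|
      iseqv := ⟨fun x u _ => rfl, fun h u hu => (h u hu).symm,
        fun h h' u hu => (h u hu).trans (h' u hu)⟩ }
  have hκ : ∀ q : Quotient s, ∃ z ∈ smallCoords f, Quotient.mk s z = q := by
    intro q
    induction q using Quotient.ind with
    | _ x =>
      obtain ⟨z, hz, -, hu⟩ := hX.exists_mem_smallCoords hf x
      exact ⟨z, hz, Quotient.sound fun u hu' => by rw [hu u hu']⟩
  choose κ hκZ hκ using hκ
  let k : X → X := fun x => κ (Quotient.mk s x)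
  have hk : ∀ x, ∀ u ∈ tightSpace f, |u (k x)| = |u x| := fun x => Quotient.exact (hκ _)
  have hkeq : ∀ x y, (∀ u ∈ tightSpace f, |u x| = |u y|) → k x = k y := fun x y hxy =>
    congrArg κ (Quotient.sound (s := s) hxy)
  have hkk : ∀ x, k (k x) = k x := fun x => hkeq _ _ (hk x)
  -- One small representative for each class on which the tight space is not identically zero.
  let R : Set X := {z | k z = z ∧ ∃ u ∈ tightSpace f, u z ≠ 0}
  have hRZ : R ⊆ smallCoords f := fun z hz => hz.1 ▸ hκZ _
  have hRfin : Finite R := (hX.finite_smallCoords hf).subset hRZ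
  have : Fintype R := Fintype.ofFinite R
  have hdich : ∀ u ∈ tightSpace f, ∀ x, u x = 0 ∨ ∃ r : R, |u x| = |u r| := by
    intro u hu x
    by_cases hx : u (k x) = 0
    · left
      rw [← abs_eq_zero, ← hk x u hu, hx, abs_zero]
    · exact Or.inr ⟨⟨k x, hkk x, u, hu, hx⟩, (hk x u hu).symm⟩
  let ev : tightSpace f →ₗ[ℝ] R → ℝ := LinearMap.funLeft ℝ ℝ Subtype.val ∘ₗ (tightSpace f).subtype
  have hev : ∀ u (r : R), ev u r = u.1 r := fun _ _ => rfl
  have hinj : Function.Injective ev := by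
    rw [injective_iff_map_eq_zero]
    intro u hu
    ext x
    rcases hdich u.1 u.2 x with h | ⟨r, hr⟩
    · exact h
    · rw [← hev, hu, Pi.zero_apply, abs_zero, abs_eq_zero] at hr
      exact hr
  have hsurj : Function.Surjective ev := by
    have hbase : ∀ r : R, ∃ u : tightSpace f, ev u = Pi.single r 1 := by
      rintro ⟨r, hr, u, hu, hur⟩
      -- Restricting u to one class stays in the tight space, since tight pairs never join different
      -- classes.
      refine ⟨⟨fun x => if k x = r then u x / u r else 0, fun x y hxy => ?_⟩, ?_⟩
      · have hkxy : k x = k y := hkeq x y fun u' hu' => by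
          rw [eq_neg_of_add_eq_zero_left (hu' x y hxy), abs_neg]
        dsimp only
        rw [hkxy]
        split_ifs
        · rw [← add_div, hu x y hxy, zero_div]
        · exact add_zero 0
      · funext r'
        rw [hev]
        by_cases h : r' = ⟨r, hr, u, hu, hur⟩
        · subst h
          simp [hr, hur]
        · rw [Pi.single_eq_of_ne h]
          have h' : (r' : X) ≠ r := fun h'' => h (Subtype.ext h'')
          dsimp only
          rw [r'.2.1, if_neg h']
    choose b hb using hbase
    intro t
    refine ⟨∑ r, t r • b r, ?_⟩
    simp only [map_sum, map_smul, hb]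
    funext r
    simp [Finset.sum_apply, Pi.single_apply]
  have hdim : polytopeDim (tightCell f) = Fintype.card R := by
    rw [polytopeDim, hX.vectorSpan_tightCell hf,
      (LinearEquiv.ofBijective ev ⟨hinj, hsurj⟩).finrank_eq, Module.finrank_fintype_fun_eq_card]
  let e : Fin (polytopeDim (tightCell f)) ≃ R := (finCongr hdim).trans (Fintype.equivFin R).symm
  refine ⟨fun i => e i, fun i => hRZ (e i).2, fun u hu x => (hdich u hu x).imp_right ?_⟩
  rintro ⟨r, hr⟩
  exact ⟨e.symm r, by simpa using hr⟩

end IsDiscreteHelly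

/-! ### The sup-metric on cells, isometry types and properness. -/

namespace InjectiveHull

variable {X : Type u} [MetricSpace X]

theorem abs_sub_le_dist (f g : InjectiveHull X) (x : X) : |f.1 x - g.1 x| ≤ dist f g :=
  le_ciSup (bddAbove_abs_sub f g) x

theorem dist_le_of_forall {f g : InjectiveHull X} {r : ℝ} (hr : 0 ≤ r)
    (h : ∀ x, |f.1 x - g.1 x| ≤ r) : dist f g ≤ r := Real.iSup_le h hr

theorem dist_e_le (f : InjectiveHull X) (v : X) : dist f (e v) ≤ f.1 v := by
  refine dist_le_of_forall (f.nonneg v) fun x => abs_le.2 ⟨?_, ?_⟩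
  · have := f.2.1 v x
    change -f.1 v ≤ f.1 x - dist v x
    linarith
  · have := f.le_add_dist v x
    change f.1 x - dist v x ≤ f.1 v
    linarith

end InjectiveHull

/-- The finitely many points with coordinates `0, 1/2, 1, 3/2, 2`. -/
def halfIntegralPoints (n : ℕ) : Set (Fin n → ℝ) :=
  {t | ∀ i, t i ∈ {r : ℝ | 0 ≤ r ∧ r ≤ 2 ∧ ∃ m : ℤ, r = m / 2}}

namespace IsDiscreteHelly

variable {X : Type u} [MetricSpace X] {f g h : X → ℝ}

/-- Differences of points of the cell lie in the tight space, so their sup-norm is attained on the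
coordinates σ. Injectivity is then transported from the extension property of the cell. -/
theorem cellIsometricTo_coordinates (hX : IsDiscreteHelly X) (hf : f ∈ extremalForms X) {n : ℕ}
    {σ : Fin n → X} (hσ : ∀ u ∈ tightSpace f, ∀ x, u x = 0 ∨ ∃ i, |u x| = |u (σ i)|) :
    CellIsometricTo (tightCell f) ((fun (g : X → ℝ) i => g (σ i)) '' tightCell f) ∧
    IsInjectiveMetricSpace.{0, w} ((fun (g : X → ℝ) i => g (σ i)) '' tightCell f) := by
  have hdist : ∀ g ∈ tightCell f, ∀ h ∈ tightCell f, ∀ x,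
      |g x - h x| ≤ dist (fun i => g (σ i)) (fun i => h (σ i)) := by
    intro g hg h hh x
    rcases hσ _ (sub_mem_tightSpace hg hh) x with h0 | ⟨i, hi⟩
    · rw [Pi.sub_apply] at h0
      rw [h0, abs_zero]
      exact dist_nonneg
    · rw [Pi.sub_apply, Pi.sub_apply] at hi
      rw [hi]
      exact dist_le_pi_dist (fun i => g (σ i)) (fun i => h (σ i)) i
  refine ⟨⟨(LinearMap.funLeft ℝ ℝ σ).toAffineMap, rfl, fun g h hg hh => le_antisymm ?_ ?_⟩, ?_⟩
  · exact (dist_pi_le_iff dist_nonneg).2 fun i => InjectiveHull.abs_sub_le_dist g h (σ i)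
  · exact InjectiveHull.dist_le_of_forall dist_nonneg (hdist g.1 hg h.1 hh)
  · intro Y _ A F hF
    choose p hpC hp using fun a => (F a).2
    obtain ⟨G, hGC, hGL, hGA⟩ := exists_lipschitz_extension_tightCell hf.1 (hX.hasTightPartners hf)
      A p hpC fun a b x => by
        refine (hdist _ (hpC a) _ (hpC b) x).trans ?_
        have h1 := hF.dist_le_mul a b
        rw [NNReal.coe_one, one_mul, Subtype.dist_eq, ← hp a, ← hp b] at h1
        exact h1
    refine ⟨fun y => ⟨_, G y, hGC y, rfl⟩, LipschitzWith.mk_one fun y y' => ?_, fun a => ?_⟩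
    · exact (dist_pi_le_iff dist_nonneg).2 fun i => hGL y y' (σ i)
    · apply Subtype.ext
      rw [← hp a, ← hGA a]

theorem isInjectiveHullComplex (hX : IsDiscreteHelly X) :
    IsInjectiveHullComplex.{u, w} X hX.hullComplex where
  sUnion_cells := by
    refine Subset.antisymm ?_ fun f hf => ⟨_, ⟨f, hf, rfl⟩, self_mem_tightCell hf.1⟩
    rintro g ⟨_, ⟨f, hf, rfl⟩, hg⟩
    exact hX.tightCell_subset_extremalForms hf hg
  locallyFinite := by
    intro f
    obtain ⟨v⟩ := hX.nonempty
    refine ⟨Metric.ball f 1, Metric.ball_mem_nhds f one_pos, ?_⟩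
    refine ((hX.finite_setOf_tightCell v (f.1 v + 1)).preimage
      Subtype.val_injective.injOn).subset ?_
    rintro ⟨C, hC⟩ ⟨g, hgC, hgf⟩
    refine ⟨hC, g.1, hgC, ?_⟩
    have h1 := (abs_le.1 (InjectiveHull.abs_sub_le_dist g f v)).2
    rw [Metric.mem_ball] at hgf
    linarith
  finite_types := by
    intro n
    have hfin : (halfIntegralPoints n).Finite := Set.Finite.pi' fun _ => finite_half_integers 2
    -- The grid is finite, so it has finitely many subsets; the vertices of a cell land on it
    -- because small coordinates lie in [0, 2].
    refine ⟨{P | IsInjectivePolytope.{w} P ∧ ∃ s ⊆ halfIntegralPoints n, P = convexHull ℝ s},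
      (hfin.finite_subsets.image (convexHull ℝ)).subset ?_, fun P hP => hP.1, ?_⟩
    · rintro _ ⟨-, s, hs, rfl⟩
      exact ⟨s, hs, rfl⟩
    · rintro _ ⟨f, hf, rfl⟩ rfl
      obtain ⟨σ, hσZ, hσ⟩ := hX.exists_coordinates hf
      obtain ⟨hiso, hinj⟩ := hX.cellIsometricTo_coordinates.{u, w} hf hσ
      have hhull : (fun (g : X → ℝ) i => g (σ i)) '' tightCell f =
          convexHull ℝ ((fun (g : X → ℝ) i => g (σ i)) '' (tightCell f).extremePoints ℝ) := by
        refine Eq.trans ?_ ((LinearMap.funLeft ℝ ℝ σ).image_convexHull _)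
        exact congrArg _ (hX.convexHull_extremePoints hf).symm
      refine ⟨_, ⟨⟨⟨_, (hX.finite_extremePoints hf).image _, ?_, hhull⟩, hinj⟩, _, ?_, hhull⟩, hiso⟩
      · rw [← convexHull_nonempty_iff (𝕜 := ℝ), ← hhull]
        exact ⟨_, f, self_mem_tightCell hf.1, rfl⟩
      · rintro _ ⟨g, hg, rfl⟩ i
        obtain ⟨hgE, -, hgn⟩ :=
          hX.extremePoints_subset_halfIntegralForms hf (self_mem_tightCell hf.1) (le_refl (f (σ i))) hg
        exact ⟨nonneg_of_mem_metricForms hgE.1 _, hσZ i g hg.1, hgn _⟩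

theorem isCellular (hX : IsDiscreteHelly X) (φ : X ≃ᵢ X) : IsCellular hX.hullComplex φ := by
  have key : ∀ (ψ : X ≃ᵢ X) (f : X → ℝ), f ∈ extremalForms X →
      (fun (g : X → ℝ) (x : X) => g (ψ.symm x)) '' tightCell f ∈ hX.hullComplex.cells := by
    intro ψ f hf
    refine ⟨_, InjectiveHull.comp_symm_mem ψ hf, Subset.antisymm ?_ fun g hg => ?_⟩
    · rintro _ ⟨g, hg, rfl⟩
      refine ⟨fun x y => ?_, fun x y hxy => ?_⟩
      · rw [← ψ.symm.dist_eq]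
        exact hg.1 _ _
      · rw [← ψ.symm.dist_eq] at hxy ⊢
        exact hg.2 _ _ hxy
    · refine ⟨fun x => g (ψ x), ⟨fun x y => ?_, fun x y hxy => ?_⟩, by simp⟩
      · rw [← ψ.dist_eq]
        exact hg.1 _ _
      · rw [← ψ.dist_eq] at hxy ⊢
        exact hg.2 _ _ (by simpa using hxy)
  intro C
  constructor
  · rintro ⟨f, hf, rfl⟩
    exact key φ f hf
  · rintro ⟨f, hf, hfC⟩
    have h1 := key φ.symm f hf
    rw [← hfC, image_image] at h1
    simpa using h1

/-- Compactness is known for pointwise convergence. On a cell this is convergence in d_∞, because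
finitely many small coordinates control all differences. -/
theorem isCompact_preimage_tightCell (hX : IsDiscreteHelly X) (hf : f ∈ extremalForms X) :
    IsCompact {g : InjectiveHull X | g.1 ∈ tightCell f} := by
  let i : tightCell f → InjectiveHull X := fun g => ⟨g.1, hX.tightCell_subset_extremalForms hf g.2⟩
  have hi : Continuous i := by
    rw [continuous_iff_continuousAt]
    intro g
    rw [ContinuousAt, Metric.tendsto_nhds]
    intro ε hε
    have hev : ∀ᶠ h : tightCell f in nhds g, ∀ z ∈ smallCoords f, |h.1 z - g.1 z| < ε / 2 := by
      rw [Filter.eventually_all_finite (hX.finite_smallCoords hf)]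
      intro z _
      have hc : Continuous fun h : tightCell f => h.1 z :=
        (continuous_apply z).comp continuous_subtype_val
      exact (Metric.tendsto_nhds.1 hc.continuousAt) _ (half_pos hε)
    filter_upwards [hev] with h hh
    refine (InjectiveHull.dist_le_of_forall (half_pos hε).le fun x => ?_).trans_lt (half_lt_self hε)
    obtain ⟨z, hz, hxz⟩ := hX.exists_abs_sub_eq hf h.2 g.2 x
    exact hxz.trans_le (hh z hz).le
  have : CompactSpace (tightCell f) :=
    isCompact_iff_compactSpace.1 (isCompact_tightCell (hX.hasTightPartners hf))
  convert isCompact_range hi using 1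
  ext g
  exact ⟨fun hg => ⟨⟨g.1, hg⟩, rfl⟩, by rintro ⟨h, rfl⟩; exact h.2⟩

theorem isCompact_setOf_le (hX : IsDiscreteHelly X) (v : X) (R : ℝ) :
    IsCompact {g : InjectiveHull X | g.1 v ≤ R} := by
  have hfin := hX.finite_setOf_tightCell v R
  refine (hfin.isCompact_biUnion (f := fun C => {g : InjectiveHull X | g.1 ∈ C}) ?_).of_isClosed_subset
    ?_ fun g hg => ?_
  · rintro _ ⟨⟨f, hf, rfl⟩, -⟩
    exact hX.isCompact_preimage_tightCell hf
  · have hc : LipschitzWith 1 fun g : InjectiveHull X => g.1 v :=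
      LipschitzWith.mk_one fun g h => InjectiveHull.abs_sub_le_dist g h v
    exact isClosed_le hc.continuous continuous_const
  · have hself := self_mem_tightCell g.2.1
    exact mem_biUnion (x := tightCell g.1) ⟨⟨g.1, g.2, rfl⟩, g.1, hself, hg⟩ hself

theorem properSpace (hX : IsDiscreteHelly X) : ProperSpace (InjectiveHull X) := by
  obtain ⟨v⟩ := hX.nonempty
  refine ⟨fun f R => (hX.isCompact_setOf_le v (f.1 v + R)).of_isClosed_subset
    Metric.isClosed_closedBall fun g hg => ?_⟩
  have h1 := (abs_le.1 (InjectiveHull.abs_sub_le_dist g f v)).2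
  rw [Metric.mem_closedBall] at hg
  change g.1 v ≤ f.1 v + R
  linarith

theorem hausdorffEDist_le_one (hX : IsDiscreteHelly X) :
    Metric.hausdorffEDist (univ : Set (InjectiveHull X)) (range InjectiveHull.e) ≤ 1 := by
  refine Metric.hausdorffEDist_le_of_mem_edist (fun f _ => ?_) fun f _ =>
    ⟨f, mem_univ f, by simp⟩
  obtain ⟨v, hv⟩ := hX.exists_le_one f.2
  refine ⟨_, ⟨v, rfl⟩, ?_⟩
  rw [edist_dist, ← ENNReal.ofReal_one]
  exact ENNReal.ofReal_le_ofReal ((f.dist_e_le v).trans hv)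

end IsDiscreteHelly

/-! ### Helly graphs and group actions. -/

section Graph

variable {V : Type u} {G : SimpleGraph V}

theorem IsLocallyFiniteGraph.finite_setOf_dist_le (hfin : IsLocallyFiniteGraph G)
    (hG : G.Connected) (x : V) (n : ℕ) : {y | G.dist x y ≤ n}.Finite := by
  induction n with
  | zero =>
    refine (finite_singleton x).subset fun y hy => ?_
    exact (hG.dist_eq_zero_iff.1 (Nat.le_zero.1 hy)).symm
  | succ n ih =>
    refine (ih.union (ih.biUnion fun z _ => hfin z)).subset fun y hy => ?_
    rcases Nat.lt_or_ge n (G.dist x y) with h | h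
    · right
      obtain ⟨p, hp⟩ := hG.exists_walk_length_eq_dist x y
      have hlt : n < p.length := by omega
      have hle : G.dist x y ≤ n + 1 := hy
      have hadj := p.adj_getVert_succ hlt
      rw [p.getVert_of_length_le (by omega : p.length ≤ n + 1)] at hadj
      refine mem_biUnion (x := p.getVert n) ?_ hadj
      have h1 := SimpleGraph.dist_le (p.take n)
      rw [p.take_length] at h1
      exact h1.trans (min_le_left _ _)
    · exact Or.inl h

theorem IsHellyGraph.isDiscreteHelly (hG : IsHellyGraph G) (hfin : IsLocallyFiniteGraph G) :
    IsDiscreteHelly (VertexSpace G hG.1) where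
  nonempty := hG.1.nonempty
  dist_integral x y := ⟨(G.dist x y : ℕ), rfl⟩
  finite_closedBall x R := by
    refine (hfin.finite_setOf_dist_le hG.1 x ⌊R⌋₊).subset
      fun (y : VertexSpace G hG.1) hy => ?_
    have h : dist x y ≤ R := Metric.mem_closedBall'.1 hy
    exact Nat.le_floor h
  helly r hr := by
    have hr0 : ∀ x, 0 ≤ r x := fun x => by
      have := hr x x
      rw [dist_self] at this
      have h2 : (0 : ℝ) ≤ r x := by linarith
      exact_mod_cast h2
    lift r to VertexSpace G hG.1 → ℕ using hr0
    have hr' : ∀ x y : V, G.dist x y ≤ r x + r y := fun x y => by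
      have := hr x y
      change (G.dist x y : ℝ) ≤ ((r x : ℤ) : ℝ) + ((r y : ℤ) : ℝ) at this
      exact_mod_cast this
    obtain ⟨z, hz⟩ := hG.2 (range fun x : V => {y | G.dist x y ≤ r x})
      (by rintro _ ⟨x, rfl⟩; exact ⟨x, r x, rfl⟩) (by
        rintro _ ⟨x, rfl⟩ _ ⟨y, rfl⟩
        -- Balls whose radii add up to at least d(x, y) meet on a geodesic, at its vertex number r x
        -- (its endpoint if r x is too large).
        obtain ⟨p, hp⟩ := hG.1.exists_walk_length_eq_dist x y
        have h1 := SimpleGraph.dist_le (p.take (r x))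
        have h2 := SimpleGraph.dist_le (p.drop (r x))
        rw [p.take_length] at h1
        rw [p.drop_length, SimpleGraph.dist_comm] at h2
        have h3 := hr' x y
        refine ⟨p.getVert (r x), h1.trans (min_le_left _ _), ?_⟩
        change G.dist y _ ≤ r y
        omega)
    refine ⟨z, fun x => ?_⟩
    have h1 : G.dist z x ≤ r x := SimpleGraph.dist_comm.trans_le (hz _ ⟨x, rfl⟩)
    change (G.dist z x : ℝ) ≤ ((r x : ℤ) : ℝ)
    exact_mod_cast h1

variable {Γ : Type v} [Group Γ] (hG : G.Connected) (ρ : Γ →* (G ≃g G))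

theorem autHullAction_e (g : Γ) (v : V) :
    (autHullAction G hG).comp ρ g (InjectiveHull.e (X := VertexSpace G hG) v) =
      InjectiveHull.e (X := VertexSpace G hG) (ρ g v) := by
  apply Subtype.ext
  funext x
  have h := (autToIsometry G hG (ρ g)).dist_eq v ((autToIsometry G hG (ρ g)).symm x)
  rw [IsometryEquiv.apply_symm_apply] at h
  exact h.symm

theorem InjectiveHull.dist_e {X : Type u} [MetricSpace X] (x y : X) :
    dist (InjectiveHull.e x) (InjectiveHull.e y) = dist x y := by
  refine le_antisymm (dist_e_le _ _) ?_
  have := abs_sub_le_dist (e x) (e y) y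
  change |dist x y - dist y y| ≤ _ at this
  rwa [dist_self, sub_zero, abs_of_nonneg dist_nonneg] at this

theorem ActsProperlyOnGraph.finite_setOf_apply_eq {ρ : Γ →* (G ≃g G)} (hρ : ActsProperlyOnGraph ρ)
    (v w : V) : {g : Γ | ρ g v = w}.Finite := by
  rcases eq_empty_or_nonempty {g : Γ | ρ g v = w} with h | ⟨a, ha⟩
  · rw [h]
    exact finite_empty
  · refine ((hρ v).image fun g => a * g).subset fun g hg => ⟨a⁻¹ * g, ?_, mul_inv_cancel_left a g⟩
    have ha' : ρ a v = w := ha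
    have hg' : ρ g v = w := hg
    change ρ (a⁻¹ * g) v = v
    rw [map_mul, RelIso.mul_apply, hg', ← ha', ← RelIso.mul_apply, ← map_mul, inv_mul_cancel,
      map_one]
    rfl

theorem ActsProperlyOnGraph.actsProperly {ρ : Γ →* (G ≃g G)} (hρ : ActsProperlyOnGraph ρ)
    (hfin : IsLocallyFiniteGraph G) : ActsProperly ((autHullAction G hG).comp ρ) := by
  intro K hK
  obtain ⟨v⟩ := hG.nonempty
  let E : V → InjectiveHull (VertexSpace G hG) := InjectiveHull.e (X := VertexSpace G hG)
  obtain ⟨R, hR⟩ := hK.isBounded.subset_closedBall (E v)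
  -- If f and g f both lie in the ball of radius R about e v, then d(v, g v) ≤ 2R by equivariance of
  -- e. So g v has finitely many possible values, each attained by finitely many g.
  refine ((hfin.finite_setOf_dist_le hG v ⌊R + R⌋₊).biUnion fun w _ =>
    hρ.finite_setOf_apply_eq v w).subset ?_
  rintro g ⟨_, ⟨f, hf, rfl⟩, hgf⟩
  refine mem_biUnion (x := ρ g v) (Nat.le_floor ?_) rfl
  have h1 : dist (E v) (E (ρ g v)) = G.dist v (ρ g v) := InjectiveHull.dist_e _ _
  have h2 := dist_triangle (E v) ((autHullAction G hG).comp ρ g f) (E (ρ g v))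
  have h3 : dist ((autHullAction G hG).comp ρ g f) (E (ρ g v)) = dist f (E v) := by
    rw [← ((autHullAction G hG).comp ρ g).dist_eq f (E v)]
    exact congrArg _ (autHullAction_e hG ρ g v).symm
  have h4 := Metric.mem_closedBall'.1 (hR hgf)
  have h5 := Metric.mem_closedBall.1 (hR hf)
  linarith

theorem ActsCocompactlyOnGraph.actsCocompactly {ρ : Γ →* (G ≃g G)}
    (hρ : ActsCocompactlyOnGraph ρ) (hX : IsDiscreteHelly (VertexSpace G hG)) :
    ActsCocompactly ((autHullAction G hG).comp ρ) := by
  obtain ⟨S, hS, hSρ⟩ := hρ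
  let E : V → InjectiveHull (VertexSpace G hG) := InjectiveHull.e (X := VertexSpace G hG)
  have := hX.properSpace
  refine ⟨⋃ s ∈ S, Metric.closedBall (E s) 1, hS.isCompact_biUnion fun s _ =>
    isCompact_closedBall _ _, eq_univ_of_forall fun f => ?_⟩
  obtain ⟨v, hv⟩ := hX.exists_le_one f.2
  obtain ⟨g, s, hs, hgs⟩ := hSρ v
  refine mem_iUnion.2 ⟨g, ((autHullAction G hG).comp ρ g).symm f, ?_,
    IsometryEquiv.apply_symm_apply _ _⟩
  refine mem_biUnion hs ?_
  rw [Metric.mem_closedBall, ← ((autHullAction G hG).comp ρ g).dist_eq,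
    IsometryEquiv.apply_symm_apply, autHullAction_e, hgs]
  exact (f.dist_e_le v).trans hv

end Graph

theorem theoremt {V : Type u} (G : SimpleGraph V) (hG : IsHellyGraph G)
    (hfin : IsLocallyFiniteGraph G) :
    ProperSpace (InjectiveHull (VertexSpace G hG.1)) ∧
    (∃ K : PolyhedralComplex (VertexSpace G hG.1 → ℝ),
      IsInjectiveHullComplex.{u, w} (VertexSpace G hG.1) K ∧
      ∀ φ : G ≃g G, IsCellular K (autToIsometry G hG.1 φ)) ∧
    Metric.hausdorffEDist (univ : Set (InjectiveHull (VertexSpace G hG.1)))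
      (range (InjectiveHull.e (X := VertexSpace G hG.1))) ≤ 1 ∧
    ∀ (Γ : Type v) [Group Γ] (ρ : Γ →* (G ≃g G)),
      (ActsProperlyOnGraph ρ → ActsProperly ((autHullAction G hG.1).comp ρ)) ∧
      (ActsGeometricallyOnGraph ρ → ActsGeometrically ((autHullAction G hG.1).comp ρ)) := by
  have hX := hG.isDiscreteHelly hfin
  refine ⟨hX.properSpace, ⟨hX.hullComplex, hX.isInjectiveHullComplex, fun φ => hX.isCellular _⟩,
    hX.hausdorffEDist_le_one, fun Γ _ ρ => ⟨fun h => h.actsProperly hG.1 hfin, fun h =>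
      ⟨h.1.actsProperly hG.1 hfin, h.2.actsCocompactly hG.1 hX⟩⟩⟩
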